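/- Let $(R,\mathfrak m)$ be a commutative Noetherian local ring that is complete (and separated) in its $\mathfrak m$-adic topology, and let $M$ be a finitely generated $R$-module. Suppose that $M$ has small cofinite irreducibles, that is, for every $n\in\mathbb N$ there is an irreducible submodule $Q$ of $M$ (a proper submodule that is not the intersection of two strictly larger submodules) such that $Q\subseteq\mathfrak m^nM$ and $M/Q$ is Artinian. Then $M$ is cyclically pure injective (CP-injective): for every exact sequence $0\to A\to B\to C\to 0$ of $R$-modules that is cyclically pure, i.e. for which $R/\mathfrak a\otimes_R A\to R/\mathfrak a\otimes_R B$ is injective for every finitely generated ideal $\mathfrak a$ of $R$, the induced sequence $$0\to\operatorname{Hom}_R(C,M)\to\operatorname{Hom}_R(B,M)\to\operatorname{Hom}_R(A,M)\to 0$$ is exact. -/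

import Mathlib

universe u v w x

/-- The sequence `0 → A --f--> B --g--> C → 0` of `R`-modules is exact and cyclically pure:
`R ⧸ a ⊗ A → R ⧸ a ⊗ B` is injective for every finitely generated ideal `a` of `R`. -/
structure IsCyclicallyPureExact {R : Type u} [CommRing R]
    {A : Type v} {B : Type w} {C : Type x}
    [AddCommGroup A] [Module R A] [AddCommGroup B] [Module R B] [AddCommGroup C] [Module R C]
    (f : A →ₗ[R] B) (g : B →ₗ[R] C) : Prop where
  injective : Function.Injective f
  exact : Function.Exact f g
  surjective : Function.Surjective g
  lTensor_injective : ∀ a : Ideal R, a.FG → Function.Injective (LinearMap.lTensor (R ⧸ a) f)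

/-- `D` is cyclically pure injective (tested against modules in the universe `w`): for every
cyclically pure exact sequence `0 → A → B → C → 0`, the induced sequence
`0 → Hom(C, D) → Hom(B, D) → Hom(A, D) → 0` is exact. -/
def IsCPInjective (R : Type u) [CommRing R] (D : Type v) [AddCommGroup D] [Module R D] : Prop :=
  ∀ (A B C : Type w) [AddCommGroup A] [Module R A] [AddCommGroup B] [Module R B]
    [AddCommGroup C] [Module R C] (f : A →ₗ[R] B) (g : B →ₗ[R] C),
    IsCyclicallyPureExact f g →
      Function.Injective (LinearMap.lcomp R D g) ∧
      Function.Exact (LinearMap.lcomp R D g) (LinearMap.lcomp R D f) ∧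
      Function.Surjective (LinearMap.lcomp R D f)

/-- `M` has small cofinite irreducibles: for every `n` there is an irreducible submodule `Q`
(proper, and not an intersection of two strictly larger submodules) with `Q ⊆ 𝔪 ^ n M` and
`M ⧸ Q` Artinian. -/
def HasSmallCofiniteIrreducibles (R : Type u) [CommRing R] [IsLocalRing R]
    (M : Type v) [AddCommGroup M] [Module R M] : Prop :=
  ∀ n : ℕ, ∃ Q : Submodule R M, InfIrred Q ∧
    Q ≤ IsLocalRing.maximalIdeal R ^ n • (⊤ : Submodule R M) ∧ IsArtinian R (M ⧸ Q)

/-!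
Each quotient `M ⧸ Q` by a cofinite irreducible `Q` is an injective module over
`R ⧸ Ann (M ⧸ Q)`: it has finite length and simple socle, so dualizing into it does not increase
length, and a nondegenerate pairing with values in it is perfect. Hence a map from a submodule
`A ⊆ B` to `M` extends to `B` modulo `Q` exactly when it sends `A ∩ Ann (M ⧸ Q) B` into `Q`. If
`A ⊆ B` is cyclically pure, this holds for every map, as then `A ∩ I B = I A` for all ideals `I`.

This criterion is inherited by unions of chains, so by Zorn's lemma there is a maximal partial map
`B ⇀ M` that extends modulo every `Q`. It is everywhere defined: the values at a new point `b` that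
are admissible modulo `Q` form a coset of a submodule containing `Q`, and these cosets have a
common point because `M` is complete with Artinian quotients `M ⧸ 𝔪 ^ n M`.
-/

open scoped TensorProduct

section Length

variable {R : Type*} [CommRing R] {N : Type*} [AddCommGroup N] [Module R N]

theorem length_linearMap_le_one_of_isSimpleModule (hN : InfIrred (⊥ : Submodule R N))
    (X : Type*) [AddCommGroup X] [Module R X] [IsSimpleModule R X] :
    Module.length R (X →ₗ[R] N) ≤ 1 := by
  rcases subsingleton_or_nontrivial (X →ₗ[R] N) with _ | hnontriv
  · simp
  refine (Module.length_eq_one_iff.mpr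
    (isSimpleModule_iff_toSpanSingleton_surjective.mpr ⟨hnontriv, fun f hf g ↦ ?_⟩)).le
  by_cases hg : g = 0
  · exact ⟨0, by simp [hg]⟩
  have range_inf_ne_bot : LinearMap.range f ⊓ LinearMap.range g ≠ ⊥ := fun h ↦
    (hN.2 h).elim (hf ∘ LinearMap.range_eq_bot.mp) (hg ∘ LinearMap.range_eq_bot.mp)
  obtain ⟨_, ⟨⟨x, rfl⟩, ⟨y, hyx⟩⟩, hfx⟩ := Submodule.exists_mem_ne_zero_of_ne_bot range_inf_ne_bot
  have hy : y ≠ 0 := by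
    rintro rfl
    exact hfx (by rw [← hyx, map_zero])
  have mem_span (z : X) : ∃ r : R, r • y = z := IsSimpleModule.toSpanSingleton_surjective R hy z
  obtain ⟨r, rfl⟩ := mem_span x
  refine ⟨r, LinearMap.ext fun z ↦ ?_⟩
  obtain ⟨s, rfl⟩ := mem_span z
  calc r • f (s • y) = s • f (r • y) := by rw [map_smul, map_smul, smul_comm]
    _ = g (s • y) := by rw [← hyx, map_smul]

theorem length_le_add_of_exact {X Y Z : Type*} [AddCommGroup X] [Module R X]
    [AddCommGroup Y] [Module R Y] [AddCommGroup Z] [Module R Z] {f : X →ₗ[R] Y} {g : Y →ₗ[R] Z}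
    (hfg : Function.Exact f g) :
    Module.length R Y ≤ Module.length R X + Module.length R Z := by
  rw [Module.length_eq_add_of_exact (LinearMap.ker g).subtype g.rangeRestrict
    (Submodule.subtype_injective _) g.surjective_rangeRestrict
    (by rw [LinearMap.exact_iff, g.ker_rangeRestrict, Submodule.range_subtype]),
    hfg.linearMap_ker_eq]
  gcongr
  · exact Module.length_le_of_surjective f.rangeRestrict f.surjective_rangeRestrict
  · exact Module.length_le_of_injective _ (Submodule.subtype_injective _)

theorem length_linearMap_le_of_isFiniteLength (hN : InfIrred (⊥ : Submodule R N))
    {X : Type*} [AddCommGroup X] [Module R X] (hX : IsFiniteLength R X) :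
    Module.length R (X →ₗ[R] N) ≤ Module.length R X := by
  induction hX with
  | of_subsingleton => simp
  | @of_simple_quotient X _ _ P _ _ ih =>
    have hP := LinearMap.exact_subtype_mkQ P
    calc Module.length R (X →ₗ[R] N)
        ≤ Module.length R ((X ⧸ P) →ₗ[R] N) + Module.length R (P →ₗ[R] N) :=
          length_le_add_of_exact
            (LinearMap.exact_lcomp_of_exact_of_surjective N hP P.mkQ_surjective)
      _ ≤ Module.length R (X ⧸ P) + Module.length R P := by
          gcongr
          rw [Module.length_eq_one R (X ⧸ P)]
          exact length_linearMap_le_one_of_isSimpleModule hN _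
      _ = Module.length R X := by
          rw [add_comm, Module.length_eq_add_of_exact _ _ P.subtype_injective P.mkQ_surjective hP]

theorem surjective_of_flip_injective (hN : InfIrred (⊥ : Submodule R N))
    {X Y : Type*} [AddCommGroup X] [Module R X] [AddCommGroup Y] [Module R Y]
    (hX : IsFiniteLength R X) (β : X →ₗ[R] Y →ₗ[R] N) (hβ : Function.Injective β.flip) :
    Function.Surjective β := by
  have hrange : IsFiniteLength R (LinearMap.range β) :=
    hX.of_surjective β.surjective_rangeRestrict
  have eval_injective : Function.Injective (LinearMap.range β).subtype.flip := by
    refine fun y z hyz ↦ hβ (LinearMap.ext fun x ↦ ?_)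
    exact LinearMap.congr_fun hyz ⟨β x, x, rfl⟩
  have length_Y_le : Module.length R Y ≤ Module.length R (LinearMap.range β) :=
    (Module.length_le_of_injective _ eval_injective).trans
      (length_linearMap_le_of_isFiniteLength hN hrange)
  have hY : IsFiniteLength R Y := Module.length_ne_top_iff.mp
    (ne_top_of_le_ne_top (Module.length_ne_top_iff.mpr hrange) length_Y_le)
  have length_dual_le := length_linearMap_le_of_isFiniteLength hN hY
  have hdual : IsFiniteLength R (Y →ₗ[R] N) := Module.length_ne_top_iff.mp
    (ne_top_of_le_ne_top (Module.length_ne_top_iff.mpr hY) length_dual_le)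
  obtain ⟨_, _⟩ := isFiniteLength_iff_isNoetherian_isArtinian.mp hdual
  rw [← LinearMap.range_eq_top]
  by_contra hne
  exact ((Submodule.length_lt hne).trans_le (length_dual_le.trans length_Y_le)).false

theorem baer_of_faithfulSMul [FaithfulSMul R N] (hN : InfIrred (⊥ : Submodule R N))
    (hfin : IsFiniteLength R N) : Module.Baer R N := by
  intro I g
  let β : N →ₗ[R] I →ₗ[R] N := (LinearMap.lsmul R N).flip.compl₂ I.subtype
  have hβ : Function.Injective β.flip := fun x y hxy ↦
    Subtype.ext (eq_of_smul_eq_smul (α := N) (LinearMap.congr_fun hxy))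
  obtain ⟨n, hn⟩ := surjective_of_flip_injective hN hfin β hβ g
  exact ⟨LinearMap.toSpanSingleton R N n, fun x hx ↦ LinearMap.congr_fun hn ⟨x, hx⟩⟩

end Length

section Extension

variable {R : Type*} [CommRing R]

theorem one_tmul_eq_zero_iff (I : Ideal R) {B : Type*} [AddCommGroup B] [Module R B] (b : B) :
    (1 : R ⧸ I) ⊗ₜ[R] b = 0 ↔ b ∈ I • (⊤ : Submodule R B) := by
  rw [← (TensorProduct.quotTensorEquivQuotSMul B I).map_eq_zero_iff,
    TensorProduct.quotTensorEquivQuotSMul_mk_one_tmul, Submodule.Quotient.mk_eq_zero]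

theorem exists_comp_eq_of_ker_le {N X Y : Type*} [AddCommGroup N] [Module R N]
    [AddCommGroup X] [Module R X] [AddCommGroup Y] [Module R Y] (hN : Module.Baer R N)
    (f : X →ₗ[R] Y) (g : X →ₗ[R] N) (hker : LinearMap.ker f ≤ LinearMap.ker g) :
    ∃ h : Y →ₗ[R] N, h ∘ₗ f = g := by
  obtain ⟨h, hh⟩ := hN.extension_property ((LinearMap.ker f).liftQ f le_rfl)
    (LinearMap.ker_eq_bot.mp (Submodule.ker_liftQ_eq_bot _ _ _ le_rfl))
    ((LinearMap.ker f).liftQ g hker)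
  refine ⟨h, LinearMap.ext fun x ↦ ?_⟩
  simpa using LinearMap.congr_fun hh (Submodule.Quotient.mk x)

theorem infIrred_bot_of_isScalarTower (S : Type*) [CommRing S] [Algebra R S] {N : Type*}
    [AddCommGroup N] [Module R N] [Module S N] [IsScalarTower R S N]
    (hN : InfIrred (⊥ : Submodule R N)) : InfIrred (⊥ : Submodule S N) := by
  refine ⟨fun h ↦ hN.1 ?_, fun P P' hPP' ↦ ?_⟩
  · rw [isMax_iff_eq_top] at h ⊢
    simpa only [Submodule.restrictScalars_bot, Submodule.restrictScalars_top]
      using congrArg (Submodule.restrictScalars R) h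
  · have := @hN.2 (P.restrictScalars R) (P'.restrictScalars R)
      (congrArg (Submodule.restrictScalars R) hPP')
    simpa only [Submodule.restrictScalars_eq_bot_iff] using this

theorem exists_comp_eq_of_baer_quotient {N A B : Type*} [AddCommGroup N] [Module R N]
    [AddCommGroup A] [Module R A] [AddCommGroup B] [Module R B] {I : Ideal R} [Module (R ⧸ I) N]
    [IsScalarTower R (R ⧸ I) N] (hN : Module.Baer (R ⧸ I) N) (f : A →ₗ[R] B) (g : A →ₗ[R] N)
    (hg : ∀ a, f a ∈ I • (⊤ : Submodule R B) → g a = 0) :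
    ∃ h : B →ₗ[R] N, h ∘ₗ f = g := by
  have hker : LinearMap.ker (f.baseChange (R ⧸ I)) ≤ LinearMap.ker (g.liftBaseChange (R ⧸ I)) := by
    intro t ht
    obtain ⟨a, rfl⟩ := TensorProduct.mk_surjective R A (R ⧸ I) Ideal.Quotient.mk_surjective t
    have hfa : (1 : R ⧸ I) ⊗ₜ[R] f a = 0 := ht
    simpa using hg a ((one_tmul_eq_zero_iff _ _).mp hfa)
  obtain ⟨h, hh⟩ := exists_comp_eq_of_ker_le hN _ _ hker
  refine ⟨h.restrictScalars R ∘ₗ TensorProduct.mk R (R ⧸ I) B 1, LinearMap.ext fun a ↦ ?_⟩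
  simpa using LinearMap.congr_fun hh (1 ⊗ₜ[R] a)

theorem exists_comp_eq_iff {N A B : Type*} [AddCommGroup N] [Module R N]
    [AddCommGroup A] [Module R A] [AddCommGroup B] [Module R B]
    (hN : InfIrred (⊥ : Submodule R N)) (hfin : IsFiniteLength R N) (f : A →ₗ[R] B)
    (g : A →ₗ[R] N) :
    (∃ h : B →ₗ[R] N, h ∘ₗ f = g) ↔
      ∀ a, f a ∈ Module.annihilator R N • (⊤ : Submodule R B) → g a = 0 := by
  constructor
  · rintro ⟨h, rfl⟩ a ha
    have := Submodule.smul_top_le_comap_smul_top _ h ha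
    rwa [← Submodule.annihilator_top, Submodule.mem_comap, Submodule.annihilator_smul] at this
  let S := R ⧸ Module.annihilator R N
  let _ : Module S N := Module.quotientAnnihilator
  have : IsScalarTower R S N := IsScalarTower.of_algebraMap_smul fun r n ↦ rfl
  have : FaithfulSMul S N := by
    rw [← Module.annihilator_eq_bot, eq_bot_iff]
    intro s hs
    obtain ⟨r, rfl⟩ := Ideal.Quotient.mk_surjective s
    exact Ideal.Quotient.eq_zero_iff_mem.mpr
      (Module.mem_annihilator.mpr fun n ↦ Module.mem_annihilator.mp hs n)
  have finiteLength : IsFiniteLength S N := by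
    obtain ⟨_, _⟩ := isFiniteLength_iff_isNoetherian_isArtinian.mp hfin
    exact isFiniteLength_iff_isNoetherian_isArtinian.mpr
      ⟨isNoetherian_of_tower R inferInstance, isArtinian_of_tower R inferInstance⟩
  exact exists_comp_eq_of_baer_quotient
    (baer_of_faithfulSMul (infIrred_bot_of_isScalarTower S hN) finiteLength) f g

end Extension

section ExtendsModulo

variable {R : Type*} [CommRing R] {B : Type*} [AddCommGroup B] [Module R B]
  {M : Type*} [AddCommGroup M] [Module R M]

theorem infIrred_bot_quotient {Q : Submodule R M} (hQ : InfIrred Q) :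
    InfIrred (⊥ : Submodule R (M ⧸ Q)) := by
  have comap_eq_iff (P : Submodule R (M ⧸ Q)) : P.comap Q.mkQ = Q ↔ P = ⊥ := by
    rw [← (Submodule.comap_injective_of_surjective Q.mkQ_surjective).eq_iff, Submodule.comap_bot,
      Q.ker_mkQ]
  refine ⟨fun h ↦ hQ.1 ?_, fun P P' h ↦ ?_⟩
  · rw [isMax_iff_eq_top] at h ⊢
    rw [← (comap_eq_iff _).mpr rfl, h, Submodule.comap_top]
  · rw [← comap_eq_iff, Submodule.comap_inf] at h
    exact (hQ.2 h).imp (comap_eq_iff P).mp (comap_eq_iff P').mp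

/-- A partial linear map `p : B →ₗ.[R] M` extends modulo `Q` if its reduction modulo `Q` is the
restriction of a linear map `B →ₗ[R] M ⧸ Q`. -/
def ExtendsModulo (p : B →ₗ.[R] M) (Q : Submodule R M) : Prop :=
  ∃ h : B →ₗ[R] M ⧸ Q, h ∘ₗ p.domain.subtype = Q.mkQ ∘ₗ p.toFun

theorem extendsModulo_iff {p : B →ₗ.[R] M} {Q : Submodule R M} (hQ : InfIrred Q)
    (hfin : IsFiniteLength R (M ⧸ Q)) :
    ExtendsModulo p Q ↔ ∀ x : p.domain,
      (x : B) ∈ Module.annihilator R (M ⧸ Q) • (⊤ : Submodule R B) → p x ∈ Q := by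
  refine (exists_comp_eq_iff (infIrred_bot_quotient hQ) hfin p.domain.subtype
    (Q.mkQ ∘ₗ p.toFun)).trans ?_
  simp only [LinearMap.comp_apply, Submodule.mkQ_apply, Submodule.Quotient.mk_eq_zero,
    Submodule.subtype_apply, LinearPMap.toFun_eq_coe]

theorem exists_maximal_extendsModulo {J : Type*} {Q : J → Submodule R M}
    (hQ : ∀ j, InfIrred (Q j)) (hfin : ∀ j, IsFiniteLength R (M ⧸ Q j)) {p : B →ₗ.[R] M}
    (hp : ∀ j, ExtendsModulo p (Q j)) :
    ∃ q, p ≤ q ∧ Maximal (fun q ↦ ∀ j, ExtendsModulo q (Q j)) q := by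
  refine zorn_le_nonempty₀ {q | ∀ j, ExtendsModulo q (Q j)} (fun c hc hchain y hy ↦ ?_) p hp
  refine ⟨LinearPMap.sSup c hchain.directedOn, fun j ↦ ?_, fun z hz ↦ LinearPMap.le_sSup _ hz⟩
  rw [extendsModulo_iff (hQ j) (hfin j)]
  rintro ⟨x, hx⟩ hxann
  obtain ⟨q, hq, hxq⟩ := (LinearPMap.mem_domain_sSup_iff ⟨y, hy⟩ hchain.directedOn).mp hx
  rw [LinearPMap.sSup_apply hchain.directedOn hq ⟨x, hxq⟩]
  exact (extendsModulo_iff (hQ j) (hfin j)).mp (hc hq j) ⟨x, hxq⟩ hxann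

/-- The set of all `m : M` whose class modulo `Q` is the value at `b` of some extension of `p`
modulo `Q`, as an affine subspace of `M`; it is empty if `p` does not extend modulo `Q`. -/
def extensionValues (p : B →ₗ.[R] M) (Q : Submodule R M) (b : B) : AffineSubspace R M where
  carrier := {m | ∃ h : B →ₗ[R] M ⧸ Q, h ∘ₗ p.domain.subtype = Q.mkQ ∘ₗ p.toFun ∧ h b = Q.mkQ m}
  smul_vsub_vadd_mem' := by
    rintro c m₁ m₂ m₃ ⟨h₁, hp₁, hm₁⟩ ⟨h₂, hp₂, hm₂⟩ ⟨h₃, hp₃, hm₃⟩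
    refine ⟨c • (h₁ - h₂) + h₃, ?_, ?_⟩
    · rw [LinearMap.add_comp, LinearMap.smul_comp, LinearMap.sub_comp, hp₁, hp₂, hp₃, sub_self,
        smul_zero, zero_add]
    · simp only [LinearMap.add_apply, LinearMap.smul_apply, LinearMap.sub_apply, hm₁, hm₂, hm₃,
        vsub_eq_sub, vadd_eq_add, map_add, map_smul, map_sub]

theorem extensionValues_mono (p : B →ₗ.[R] M) (b : B) {Q Q' : Submodule R M} (h : Q ≤ Q') :
    extensionValues p Q b ≤ extensionValues p Q' b := by
  rintro m ⟨k, hk, hkb⟩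
  refine ⟨Submodule.factor h ∘ₗ k, ?_, ?_⟩
  · rw [LinearMap.comp_assoc, hk, ← LinearMap.comp_assoc, Submodule.factor_comp_mk]
  · rw [LinearMap.comp_apply, hkb, ← LinearMap.comp_apply, Submodule.factor_comp_mk]

theorem ExtendsModulo.extensionValues_nonempty {p : B →ₗ.[R] M} {Q : Submodule R M}
    (hp : ExtendsModulo p Q) (b : B) : (extensionValues p Q b : Set M).Nonempty := by
  obtain ⟨h, hh⟩ := hp
  obtain ⟨m, hm⟩ := Q.mkQ_surjective (h b)
  exact ⟨m, h, hh, hm.symm⟩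

theorem ExtendsModulo.le_direction_extensionValues {p : B →ₗ.[R] M} {Q : Submodule R M}
    (hp : ExtendsModulo p Q) (b : B) : Q ≤ (extensionValues p Q b).direction := by
  intro v hv
  obtain ⟨m, h, hh, hb⟩ := hp.extensionValues_nonempty b
  have hvm : v + m ∈ extensionValues p Q b :=
    ⟨h, hh, by rw [hb, map_add, Q.mkQ_apply v, (Submodule.Quotient.mk_eq_zero Q).mpr hv, zero_add]⟩
  simpa using AffineSubspace.vsub_mem_direction hvm ⟨h, hh, hb⟩

theorem exists_linearPMap_le_domain_eq_sup {p : B →ₗ.[R] M} {b : B} {m : M}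
    (H : ∀ (x : p.domain) (c : R), (x : B) = c • b → p x = c • m) :
    ∃ q, p ≤ q ∧ q.domain = p.domain ⊔ R ∙ b ∧
      ∀ (x : p.domain) (c : R) (hx : (x : B) + c • b ∈ q.domain),
        q ⟨x + c • b, hx⟩ = p x + c • m := by
  let s : B →ₗ.[R] M := LinearPMap.mkSpanSingleton' b m fun c hc ↦
    (H 0 c hc.symm).symm.trans p.map_zero
  have hs (c : R) (hc : c • b ∈ s.domain) : s ⟨c • b, hc⟩ = c • m :=
    LinearPMap.mkSpanSingleton'_apply ..
  have compatible (x : p.domain) (y : s.domain) (hxy : (x : B) = y) : p x = s y := by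
    obtain ⟨y, hy⟩ := y
    obtain ⟨c, rfl⟩ := Submodule.mem_span_singleton.mp hy
    rw [hs, H x c hxy]
  refine ⟨p.sup s compatible, p.left_le_sup s compatible, rfl, fun x c hx ↦ ?_⟩
  have hc : c • b ∈ s.domain := Submodule.mem_span_singleton.mpr ⟨c, rfl⟩
  rw [← hs c hc]
  exact LinearPMap.sup_apply compatible x ⟨c • b, hc⟩ ⟨x + c • b, hx⟩ rfl

theorem exists_le_mem_domain_of_mem_extensionValues {J : Type*} {Q : J → Submodule R M}
    (hQ : ⨅ j, Q j = ⊥) {p : B →ₗ.[R] M} {b : B} {m : M}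
    (hm : ∀ j, m ∈ extensionValues p (Q j) b) :
    ∃ q, p ≤ q ∧ b ∈ q.domain ∧ ∀ j, ExtendsModulo q (Q j) := by
  choose h hp hb using hm
  replace hp (j : J) (x : p.domain) : h j x = (Q j).mkQ (p x) := LinearMap.congr_fun (hp j) x
  have apply_eq_smul (x : p.domain) (c : R) (hx : (x : B) = c • b) : p x = c • m := by
    rw [← sub_eq_zero, ← Submodule.mem_bot R, ← hQ, Submodule.mem_iInf]
    intro j
    rw [← Submodule.Quotient.eq, ← Submodule.mkQ_apply, ← Submodule.mkQ_apply, map_smul, ← hb j,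
      ← map_smul, ← hx, hp]
  obtain ⟨q, hpq, hdom, hq⟩ := exists_linearPMap_le_domain_eq_sup apply_eq_smul
  refine ⟨q, hpq, hdom ▸ Submodule.mem_sup_right (Submodule.mem_span_singleton_self b),
    fun j ↦ ⟨h j, ?_⟩⟩
  ext ⟨z, hz⟩
  obtain ⟨x, hx, y, hy, rfl⟩ := Submodule.mem_sup.mp (hdom ▸ hz)
  obtain ⟨c, rfl⟩ := Submodule.mem_span_singleton.mp hy
  calc h j (x + c • b) = (Q j).mkQ (p ⟨x, hx⟩ + c • m) := by
        rw [map_add, map_smul, hb, map_add, map_smul, ← hp]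
    _ = (Q j).mkQ (q ⟨x + c • b, hz⟩) := by rw [← hq ⟨x, hx⟩ c hz]

end ExtendsModulo

section LinearCompactness

variable {R : Type*} [CommRing R] {M : Type*} [AddCommGroup M] [Module R M] {J : Type*}
  {W : J → AffineSubspace R M}

theorem exists_forall_map_le_of_isArtinian [Nonempty J] {N : Type*} [AddCommGroup N] [Module R N]
    [IsArtinian R N] (hdir : Directed (· ≥ ·) W) (hne : ∀ j, (W j : Set M).Nonempty)
    (π : M →ᵃ[R] N) : ∃ i, ∀ j, (W i).map π ≤ (W j).map π := by
  obtain ⟨_, ⟨i, rfl⟩, hmin⟩ := IsArtinian.set_has_minimal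
    (Set.range fun j ↦ ((W j).map π).direction) (Set.range_nonempty _)
  refine ⟨i, fun j ↦ ?_⟩
  obtain ⟨k, hki, hkj⟩ := hdir i j
  have hmap_ki : (W k).map π ≤ (W i).map π := AffineSubspace.map_mono π hki
  have heq : (W k).map π = (W i).map π :=
    AffineSubspace.eq_of_direction_eq_of_nonempty_of_le
      ((AffineSubspace.direction_le hmap_ki).eq_of_not_lt (hmin _ ⟨k, rfl⟩))
      ((hne k).image π) hmap_ki
  exact heq.ge.trans (AffineSubspace.map_mono π hkj)

theorem exists_forall_mem_of_isPrecomplete [Nonempty J] (I : Ideal R) [IsPrecomplete I M]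
    (hM : ∀ n, IsArtinian R (M ⧸ (I ^ n • ⊤ : Submodule R M))) (hdir : Directed (· ≥ ·) W)
    (hne : ∀ j, (W j : Set M).Nonempty) (hW : ∀ j, ∃ n, I ^ n • ⊤ ≤ (W j).direction) :
    ∃ m, ∀ j, m ∈ W j := by
  choose i hi using fun n ↦ exists_forall_map_le_of_isArtinian hdir hne
    (I ^ n • ⊤ : Submodule R M).mkQ.toAffineMap
  have exists_smodEq {n : ℕ} {y : M} (hy : y ∈ W (i n)) (j : J) :
      ∃ z ∈ W j, z ≡ y [SMOD (I ^ n • ⊤ : Submodule R M)] :=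
    hi n j (AffineSubspace.mem_map_of_mem _ hy)
  choose! next next_mem next_smodEq using
    fun (n : ℕ) (y : M) (hy : y ∈ W (i n)) ↦ exists_smodEq hy (i (n + 1))
  obtain ⟨y₀, hy₀⟩ := hne (i 0)
  let y : ℕ → M := Nat.rec y₀ next
  have y_mem (n : ℕ) : y n ∈ W (i n) := by
    induction n with
    | zero => exact hy₀
    | succ n ih => exact next_mem n _ ih
  have y_cauchy : AdicCompletion.IsAdicCauchy I M y :=
    (AdicCompletion.isAdicCauchy_iff I M y).mpr fun n ↦ (next_smodEq n _ (y_mem n)).symm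
  obtain ⟨m, hm⟩ := IsPrecomplete.prec ‹_› y_cauchy
  refine ⟨m, fun j ↦ ?_⟩
  obtain ⟨n, hn⟩ := hW j
  obtain ⟨z, hz, hzy⟩ := exists_smodEq (y_mem n) j
  have hmz : m - z ∈ (W j).direction := hn (SModEq.sub_mem.mp (hzy.trans (hm n)).symm)
  simpa using AffineSubspace.vadd_mem_of_mem_direction hmz hz

variable {B : Type*} [AddCommGroup B] [Module R B]

theorem exists_linearMap_extending_of_extendsModulo (I : Ideal R) [IsAdicComplete I M]
    {Q : J → Submodule R M} (hQ : ∀ j, InfIrred (Q j))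
    (hfin : ∀ j, IsFiniteLength R (M ⧸ Q j)) (hdir : Directed (· ≥ ·) Q)
    (hopen : ∀ j, ∃ n, I ^ n • ⊤ ≤ Q j) (hsmall : ∀ n, ∃ j, Q j ≤ I ^ n • ⊤)
    {p : B →ₗ.[R] M} (hp : ∀ j, ExtendsModulo p (Q j)) :
    ∃ h : B →ₗ[R] M, ∀ x : p.domain, h x = p x := by
  obtain ⟨q, hpq, hq⟩ := exists_maximal_extendsModulo hQ hfin hp
  have : Nonempty J := (hsmall 0).nonempty
  have iInf_eq_bot : ⨅ j, Q j = ⊥ := by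
    rw [eq_bot_iff, ← IsHausdorff.iInf_pow_smul (I := I) (M := M) inferInstance]
    exact le_iInf fun n ↦ (hsmall n).elim fun j hj ↦ (iInf_le Q j).trans hj
  have isArtinian_quotient (n : ℕ) : IsArtinian R (M ⧸ (I ^ n • ⊤ : Submodule R M)) := by
    obtain ⟨j, hj⟩ := hsmall n
    obtain ⟨_, _⟩ := isFiniteLength_iff_isNoetherian_isArtinian.mp (hfin j)
    exact isArtinian_of_surjective _ _ (Submodule.factor_surjective hj)
  have mem_domain (b : B) : b ∈ q.domain := by
    obtain ⟨m, hm⟩ := exists_forall_mem_of_isPrecomplete I isArtinian_quotient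
      (hdir.mono_comp _ fun _ _ h ↦ extensionValues_mono q b h)
      (fun j ↦ (hq.prop j).extensionValues_nonempty b)
      (fun j ↦ (hopen j).imp fun n hn ↦ hn.trans ((hq.prop j).le_direction_extensionValues b))
    obtain ⟨r, hqr, hbr, hr⟩ := exists_le_mem_domain_of_mem_extensionValues iInf_eq_bot hm
    exact (hq.le_of_ge hr hqr).1 hbr
  refine ⟨q.toFun ∘ₗ LinearMap.id.codRestrict q.domain mem_domain, fun x ↦ ?_⟩
  exact (hpq.2 rfl).symm

end LinearCompactness

section CyclicPurity

theorem exists_fg_le_mem_smul_top {R : Type*} [CommRing R] {B : Type*} [AddCommGroup B] [Module R B]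
    {I : Ideal R} {b : B} (hb : b ∈ I • (⊤ : Submodule R B)) :
    ∃ J ≤ I, J.FG ∧ b ∈ J • (⊤ : Submodule R B) := by
  induction hb using Submodule.smul_induction_on' with
  | smul r hr b _ =>
    exact ⟨Ideal.span {r}, (Ideal.span_singleton_le_iff_mem I).mpr hr, ⟨{r}, by simp⟩,
      Submodule.smul_mem_smul (Ideal.mem_span_singleton_self r) trivial⟩
  | add b _ b' _ ih ih' =>
    obtain ⟨J, hJ, hfg, hb⟩ := ih
    obtain ⟨J', hJ', hfg', hb'⟩ := ih'
    exact ⟨J ⊔ J', sup_le hJ hJ', Submodule.FG.sup hfg hfg',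
      add_mem (Submodule.smul_mono_left le_sup_left hb) (Submodule.smul_mono_left le_sup_right hb')⟩

theorem IsCyclicallyPureExact.mem_smul_top_of_apply_mem {R : Type*} [CommRing R] {A B C : Type*}
    [AddCommGroup A] [Module R A] [AddCommGroup B] [Module R B] [AddCommGroup C] [Module R C]
    {f : A →ₗ[R] B} {g : B →ₗ[R] C} (h : IsCyclicallyPureExact f g) {I : Ideal R} {a : A}
    (ha : f a ∈ I • (⊤ : Submodule R B)) : a ∈ I • (⊤ : Submodule R A) := by
  obtain ⟨J, hJI, hJ, hfa⟩ := exists_fg_le_mem_smul_top ha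
  rw [← one_tmul_eq_zero_iff, ← LinearMap.lTensor_tmul,
    (injective_iff_map_eq_zero' _).mp (h.lTensor_injective J hJ), one_tmul_eq_zero_iff] at hfa
  exact Submodule.smul_mono_left hJI hfa

theorem IsCyclicallyPureExact.exists_comp_eq {R : Type*} [CommRing R] {A B C : Type*}
    [AddCommGroup A] [Module R A] [AddCommGroup B] [Module R B] [AddCommGroup C] [Module R C]
    {f : A →ₗ[R] B} {g : B →ₗ[R] C} (h : IsCyclicallyPureExact f g) {N : Type*} [AddCommGroup N]
    [Module R N] (hN : InfIrred (⊥ : Submodule R N)) (hfin : IsFiniteLength R N) (φ : A →ₗ[R] N) :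
    ∃ ψ : B →ₗ[R] N, ψ ∘ₗ f = φ :=
  (exists_comp_eq_iff hN hfin f φ).mpr fun _ ha ↦
    (exists_comp_eq_iff hN hfin LinearMap.id φ).mp ⟨φ, φ.comp_id⟩ _ (h.mem_smul_top_of_apply_mem ha)

end CyclicPurity

section LocalRing

theorem isPrecomplete_of_finite {R : Type*} [CommRing R] (I : Ideal R) [IsPrecomplete I R]
    (M : Type*) [AddCommGroup M] [Module R M] [Module.Finite R M] : IsPrecomplete I M := by
  rw [← AdicCompletion.of_surjective_iff, ← LinearMap.range_eq_top, eq_top_iff]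
  rintro y -
  obtain ⟨t, rfl⟩ := AdicCompletion.ofTensorProduct_surjective_of_finite I M y
  induction t with
  | zero => simp
  | add s t hs ht => simpa using add_mem hs ht
  | tmul r m =>
    obtain ⟨r, rfl⟩ := AdicCompletion.of_surjective I R r
    refine ⟨r • m, ?_⟩
    rw [AdicCompletion.ofTensorProduct_tmul, map_smul]
    ext n
    rfl

theorem exists_maximalIdeal_pow_smul_top_le {R : Type*} [CommRing R] [IsLocalRing R]
    {M : Type*} [AddCommGroup M] [Module R M] [Module.Finite R M] (Q : Submodule R M)
    [IsArtinian R (M ⧸ Q)] : ∃ n, IsLocalRing.maximalIdeal R ^ n • (⊤ : Submodule R M) ≤ Q := by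
  let 𝔪 := IsLocalRing.maximalIdeal R
  have : IsNoetherian R (M ⧸ Q) := isNoetherian_of_finite_isArtinian _
  obtain ⟨n, hn⟩ := IsArtinian.monotone_stabilizes (R := R) (M := M ⧸ Q)
    ⟨fun n ↦ OrderDual.toDual (𝔪 ^ n • ⊤), fun _ _ h ↦
      Submodule.smul_mono_left (Ideal.pow_le_pow_right h)⟩
  have pow_smul_eq : 𝔪 ^ n • (⊤ : Submodule R (M ⧸ Q)) = 𝔪 ^ (n + 1) • ⊤ := hn (n + 1) n.le_succ
  have pow_smul_eq_bot : 𝔪 ^ n • (⊤ : Submodule R (M ⧸ Q)) = ⊥ := by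
    refine Submodule.eq_bot_of_le_smul_of_le_jacobson_bot 𝔪 _ (IsNoetherian.noetherian _) ?_
      (IsLocalRing.maximalIdeal_le_jacobson _)
    rw [← Submodule.mul_smul, ← pow_succ']
    exact pow_smul_eq.le
  refine ⟨n, ?_⟩
  rw [← Q.ker_mkQ, LinearMap.le_ker_iff_map, Submodule.map_smul'', Submodule.map_top, Q.range_mkQ]
  exact pow_smul_eq_bot

theorem HasSmallCofiniteIrreducibles.exists_linearMap_extending {R : Type*} [CommRing R]
    [IsLocalRing R] {M : Type*} [AddCommGroup M] [Module R M] [Module.Finite R M]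
    [IsAdicComplete (IsLocalRing.maximalIdeal R) M] (hM : HasSmallCofiniteIrreducibles R M)
    {B : Type*} [AddCommGroup B] [Module R B] {p : B →ₗ.[R] M}
    (hp : ∀ Q : Submodule R M, InfIrred Q → IsFiniteLength R (M ⧸ Q) → ExtendsModulo p Q) :
    ∃ h : B →ₗ[R] M, ∀ x : p.domain, h x = p x := by
  choose Q irreducible small artinian using hM
  have finiteLength (n : ℕ) : IsFiniteLength R (M ⧸ Q n) :=
    isFiniteLength_iff_isNoetherian_isArtinian.mpr ⟨isNoetherian_of_finite_isArtinian _, artinian n⟩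
  have isOpen (n : ℕ) := exists_maximalIdeal_pow_smul_top_le (Q n)
  have directed : Directed (· ≥ ·) Q := by
    intro i j
    obtain ⟨m, hm⟩ := isOpen i
    obtain ⟨n, hn⟩ := isOpen j
    refine ⟨max m n, ?_, ?_⟩
    · exact ((small _).trans (Submodule.pow_smul_top_le _ M (le_max_left m n))).trans hm
    · exact ((small _).trans (Submodule.pow_smul_top_le _ M (le_max_right m n))).trans hn
  exact exists_linearMap_extending_of_extendsModulo (IsLocalRing.maximalIdeal R) irreducible
    finiteLength directed isOpen (fun n ↦ ⟨n, small n⟩)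
    fun n ↦ hp _ (irreducible n) (finiteLength n)

end LocalRing

theorem corollary5p9_general (R : Type u) [CommRing R] [IsLocalRing R]
    (M : Type v) [AddCommGroup M] [Module R M] [Module.Finite R M]
    [IsAdicComplete (IsLocalRing.maximalIdeal R) M]
    (hM : HasSmallCofiniteIrreducibles R M) :
    IsCPInjective.{u, v, w} R M := by
  intro A B C _ _ _ _ _ _ f g h
  refine ⟨LinearMap.lcomp_injective_of_surjective g h.surjective,
    LinearMap.exact_lcomp_of_exact_of_surjective M h.exact h.surjective, fun φ ↦ ?_⟩
  let e := LinearEquiv.ofInjective f h.injective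
  let p : B →ₗ.[R] M := ⟨LinearMap.range f, φ ∘ₗ e.symm⟩
  have hp (Q : Submodule R M) (hQ : InfIrred Q) (hfin : IsFiniteLength R (M ⧸ Q)) :
      ExtendsModulo p Q := by
    obtain ⟨ψ, hψ⟩ := h.exists_comp_eq (infIrred_bot_quotient hQ) hfin (Q.mkQ ∘ₗ φ)
    refine ⟨ψ, ?_⟩
    ext ⟨_, a, rfl⟩
    exact (LinearMap.congr_fun hψ a).trans (congrArg (Q.mkQ ∘ₗ φ) (e.symm_apply_apply a).symm)
  obtain ⟨ψ, hψ⟩ := hM.exists_linearMap_extending hp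
  refine ⟨ψ, LinearMap.ext fun a ↦ ?_⟩
  simpa [p, e] using hψ (e a)

theorem corollary5p9 (R : Type u) [CommRing R] [IsLocalRing R] [IsNoetherianRing R]
    [IsAdicComplete (IsLocalRing.maximalIdeal R) R]
    (M : Type v) [AddCommGroup M] [Module R M] [Module.Finite R M]
    (hM : HasSmallCofiniteIrreducibles R M) :
    IsCPInjective.{u, v, w} R M := by
  have := isPrecomplete_of_finite (IsLocalRing.maximalIdeal R) M
  have : IsAdicComplete (IsLocalRing.maximalIdeal R) M := {}
  exact corollary5p9_general R M hM
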